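/- Let $\beta=(\beta(j))_{j\ge 0}$ be a sequence of positive real numbers with $\liminf_{j\to\infty}\beta(j)^{1/j}\ge 1$ (the value $\infty$ is allowed), and let $H^2(\beta)$ be the weighted Hardy space of all functions $f$ analytic on the open unit disk $\mathbb{D}$ whose Maclaurin coefficients $\hat f(j)$ satisfy $\sum_{j\ge0}|\hat f(j)|^2\beta(j)^2<\infty$, with inner product $\langle f,g\rangle=\sum_{j\ge0}\hat f(j)\overline{\hat g(j)}\beta(j)^2$. Let $\psi:\mathbb{D}\to\mathbb{C}$ and $\varphi:\mathbb{D}\to\mathbb{D}$ be analytic, and suppose that the weighted composition operator $W_{\psi,\varphi}f=\psi\cdot(f\circ\varphi)$ is a bounded, invertible operator from $H^2(\beta)$ to $H^2(\beta)$. Then $\varphi$ is an automorphism of $\mathbb{D}$ (a bijection of $\mathbb{D}$ onto itself that is analytic with analytic inverse). Moreover, if $\liminf_{j\to\infty}\beta(j)^{1/j}>1$ (including the case where it equals $\infty$), then $\varphi$ is a rotation: there is $\zeta\in\mathbb{C}$ with $|\zeta|=1$ such that $\varphi(z)=\zeta z$ for all $z\in\mathbb{D}$. -/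

import Mathlib

open Filter Topology
open scoped ENNReal Complex.UnitDisc ComplexConjugate

noncomputable section

namespace WeightedHardy

/-- The extension by zero to `ℂ` of a function on the open unit disk. -/
def zeroExt (f : 𝔻 → ℂ) : ℂ → ℂ :=
  fun z => if h : ‖z‖ < 1 then f (Complex.UnitDisc.mk z h) else 0

/-- `f` is analytic on the open unit disk. -/
def IsAnalyticOnDisk (f : 𝔻 → ℂ) : Prop :=
  DifferentiableOn ℂ (zeroExt f) (Metric.ball 0 1)

/-- The `j`-th Maclaurin coefficient of `f`. -/
def coeff (f : 𝔻 → ℂ) (j : ℕ) : ℂ :=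
  iteratedDeriv j (zeroExt f) 0 / (Nat.factorial j : ℂ)

/-- `liminf β(j)^{1/j}`, as an extended nonnegative real number (so that the value `∞` is
meaningful). The value of the sequence at `j = 0` is irrelevant. -/
def rootLiminf (β : ℕ → ℝ) : ℝ≥0∞ :=
  liminf (fun j : ℕ => ENNReal.ofReal (β j ^ (1 / (j : ℝ)))) atTop

/-- Weight sequences of weighted Hardy spaces of the disk: positive sequences with
`liminf β(j)^{1/j} ≥ 1`. The normalization `β(0) = 1` is not imposed. -/
structure WeightSequence where
  toFun : ℕ → ℝ
  pos : ∀ j, 0 < toFun j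
  one_le_rootLiminf : 1 ≤ rootLiminf toFun

instance : CoeFun WeightSequence (fun _ => ℕ → ℝ) := ⟨WeightSequence.toFun⟩

lemma zeroExt_coe (f : 𝔻 → ℂ) (z : 𝔻) : zeroExt f (z : ℂ) = f z := by
  unfold zeroExt
  rw [dif_pos z.norm_lt_one]
  rfl

lemma zeroExt_zero : zeroExt 0 = 0 := by
  funext z
  simp [zeroExt]

lemma zeroExt_add (f g : 𝔻 → ℂ) : zeroExt (f + g) = zeroExt f + zeroExt g := by
  funext z
  by_cases h : ‖z‖ < 1 <;> simp [zeroExt, h]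

lemma zeroExt_smul (c : ℂ) (f : 𝔻 → ℂ) : zeroExt (c • f) = c • zeroExt f := by
  funext z
  by_cases h : ‖z‖ < 1 <;> simp [zeroExt, h]

lemma coeff_zero (j : ℕ) : coeff 0 j = 0 := by
  rw [coeff, zeroExt_zero, Pi.zero_def, iteratedDeriv_const]
  split_ifs <;> simp

lemma coeff_add {f g : 𝔻 → ℂ} (hf : IsAnalyticOnDisk f) (hg : IsAnalyticOnDisk g) (j : ℕ) :
    coeff (f + g) j = coeff f j + coeff g j := by
  have h0 : Metric.ball (0 : ℂ) 1 ∈ 𝓝 (0 : ℂ) := Metric.ball_mem_nhds 0 one_pos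
  rw [coeff, zeroExt_add, iteratedDeriv_add (hf.analyticAt h0).contDiffAt
    (hg.analyticAt h0).contDiffAt, add_div]
  rfl

lemma coeff_smul (c : ℂ) (f : 𝔻 → ℂ) (j : ℕ) : coeff (c • f) j = c * coeff f j := by
  rw [coeff, zeroExt_smul, coeff, iteratedDeriv_const_smul_field, smul_eq_mul,
    mul_div_assoc]

/-- A function analytic on the disk all of whose Maclaurin coefficients vanish is zero. -/
lemma eq_zero_of_coeff {f : 𝔻 → ℂ} (hf : IsAnalyticOnDisk f) (h : ∀ j, coeff f j = 0) :
    f = 0 := by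
  funext z
  have hz : (z : ℂ) ∈ Metric.ball (0 : ℂ) 1 := by simpa using z.norm_lt_one
  have key := Complex.taylorSeries_eq_on_ball (r := 1) (by simpa [IsAnalyticOnDisk] using hf) hz
  have h' : ∀ n, iteratedDeriv n (zeroExt f) 0 = 0 := fun n => by
    have hn := h n
    rw [coeff, div_eq_zero_iff] at hn
    exact hn.resolve_right (Nat.cast_ne_zero.mpr n.factorial_ne_zero)
  rw [zeroExt_coe] at key
  simpa [h'] using key.symm

/-- The linear space of the functions `f` analytic on the open unit disk with
`∑ |f̂(j)|² β(j)² < ∞`. -/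
def carrier (β : WeightSequence) : Submodule ℂ (𝔻 → ℂ) where
  carrier := {f | IsAnalyticOnDisk f ∧ Summable fun j => ‖coeff f j‖ ^ 2 * β j ^ 2}
  zero_mem' := by
    refine ⟨?_, by simp [coeff_zero]⟩
    rw [IsAnalyticOnDisk, zeroExt_zero]
    exact differentiableOn_const 0
  add_mem' := by
    rintro f g ⟨hf, hf'⟩ ⟨hg, hg'⟩
    refine ⟨?_, ?_⟩
    · rw [IsAnalyticOnDisk, zeroExt_add]
      exact hf.add hg
    · refine Summable.of_nonneg_of_le (fun j => by positivity) (fun j => ?_)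
        ((hf'.add hg').mul_left 2)
      rw [coeff_add hf hg]
      have h1 : ‖coeff f j + coeff g j‖ ^ 2 ≤ 2 * (‖coeff f j‖ ^ 2 + ‖coeff g j‖ ^ 2) := by
        have := norm_add_le (coeff f j) (coeff g j)
        nlinarith [sq_nonneg (‖coeff f j‖ - ‖coeff g j‖), norm_nonneg (coeff f j + coeff g j)]
      nlinarith [mul_le_mul_of_nonneg_right h1 (sq_nonneg (β j))]
  smul_mem' := by
    rintro c f ⟨hf, hf'⟩
    refine ⟨?_, ?_⟩
    · rw [IsAnalyticOnDisk, zeroExt_smul]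
      exact hf.const_smul c
    · refine (hf'.mul_left (‖c‖ ^ 2)).congr fun j => ?_
      rw [coeff_smul, norm_mul]
      ring

/-- The weighted Hardy space `H²(β)`. -/
def H2 (β : WeightSequence) : Type := carrier β

namespace H2

variable {β : WeightSequence}

instance : AddCommGroup (H2 β) := inferInstanceAs (AddCommGroup (carrier β))

instance : Module ℂ (H2 β) := inferInstanceAs (Module ℂ (carrier β))

instance : FunLike (H2 β) 𝔻 ℂ where
  coe f := f.1
  coe_injective := Subtype.coe_injective

lemma coe_add (f g : H2 β) : ⇑(f + g) = ⇑f + ⇑g := rfl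

lemma coe_smul (c : ℂ) (f : H2 β) : ⇑(c • f) = c • ⇑f := rfl

lemma summable_inner (f g : H2 β) :
    Summable fun j => conj (coeff f j) * coeff g j * (β j : ℂ) ^ 2 := by
  refine Summable.of_norm_bounded (f.2.2.add g.2.2) fun j => ?_
  rw [norm_mul, norm_mul, RCLike.norm_conj, norm_pow, Complex.norm_real, Real.norm_eq_abs, sq_abs,
    ← add_mul]
  refine mul_le_mul_of_nonneg_right ?_ (sq_nonneg _)
  change ‖coeff f j‖ * ‖coeff g j‖ ≤ ‖coeff f j‖ ^ 2 + ‖coeff g j‖ ^ 2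
  nlinarith [sq_nonneg (‖coeff f j‖ - ‖coeff g j‖), sq_nonneg (‖coeff f j‖),
    sq_nonneg (‖coeff g j‖)]

lemma inner_term_self (f : H2 β) (j : ℕ) :
    conj (coeff f j) * coeff f j * (β j : ℂ) ^ 2 =
      ((‖coeff f j‖ ^ 2 * β j ^ 2 : ℝ) : ℂ) := by
  rw [Complex.conj_mul']
  push_cast
  rfl

/-- The inner product `∑ f̂(j) conj(ĝ(j)) β(j)²` of `H²(β)`; by Mathlib's convention it is
`inner g f`, conjugate linear in the first variable. -/
@[reducible] def core (β : WeightSequence) : InnerProductSpace.Core ℂ (H2 β) where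
  inner g f := ∑' j, conj (coeff g j) * coeff f j * (β j : ℂ) ^ 2
  conj_inner_symm f g := by
    rw [Complex.conj_tsum]
    refine tsum_congr fun j => ?_
    simp only [map_mul, map_pow, Complex.conj_conj, Complex.conj_ofReal]
    ring
  re_inner_nonneg f := by
    simp only [inner_term_self]
    rw [← Complex.ofReal_tsum]
    exact tsum_nonneg fun j => by positivity
  add_left f g h := by
    rw [← (summable_inner f h).tsum_add (summable_inner g h)]
    refine tsum_congr fun j => ?_
    rw [coe_add, coeff_add (f := ⇑f) (g := ⇑g) f.2.1 g.2.1, map_add]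
    ring
  smul_left f g c := by
    rw [← tsum_mul_left]
    refine tsum_congr fun j => ?_
    rw [coe_smul, coeff_smul, map_mul]
    ring
  definite f hf := by
    simp only [inner_term_self] at hf
    rw [← Complex.ofReal_tsum, Complex.ofReal_eq_zero] at hf
    have hs : Summable fun j => ‖coeff f j‖ ^ 2 * β j ^ 2 := f.2.2
    have hf' := (hasSum_zero_iff_of_nonneg fun j => by positivity).mp (hf ▸ hs.hasSum)
    refine Subtype.ext (eq_zero_of_coeff f.2.1 fun j => ?_)
    have hj := congrFun hf' j
    have hb := β.pos j
    change coeff f j = 0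
    simpa [hb.ne'] using hj

instance : NormedAddCommGroup (H2 β) :=
  @InnerProductSpace.Core.toNormedAddCommGroup ℂ (H2 β) _ _ _ (core β)

instance : InnerProductSpace ℂ (H2 β) := InnerProductSpace.ofCore (core β).toCore

end H2

/-- The function `ψ · (f ∘ φ)`. -/
def weightedComp (ψ : 𝔻 → ℂ) (φ : 𝔻 → 𝔻) (f : 𝔻 → ℂ) : 𝔻 → ℂ :=
  fun z => ψ z * f (φ z)

/-- `φ` is an analytic selfmap of the open unit disk. -/
def IsAnalyticSelfmap (φ : 𝔻 → 𝔻) : Prop :=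
  IsAnalyticOnDisk fun z => (φ z : ℂ)

/-- `φ` is a (conformal) automorphism of the open unit disk. -/
def IsDiskAutomorphism (φ : 𝔻 → 𝔻) : Prop :=
  IsAnalyticSelfmap φ ∧
    ∃ χ : 𝔻 → 𝔻, IsAnalyticSelfmap χ ∧ Function.LeftInverse χ φ ∧ Function.RightInverse χ φ

/-- `φ` is a rotation `z ↦ ζ z` with `|ζ| = 1`. -/
def IsRotation (φ : 𝔻 → 𝔻) : Prop :=
  ∃ ζ : ℂ, ‖ζ‖ = 1 ∧ ∀ z : 𝔻, (φ z : ℂ) = ζ * (z : ℂ)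

end WeightedHardy

end

noncomputable section

namespace WeightedHardy

open FormalMultilinearSeries

/-! ### Growth of the weights against geometric sequences. -/

section Radius

/-! Let `R = rootLiminf β` and let `domain β` be the disk `|z| < R` (the plane if `R = ∞`).
Functions in `H²(β)` continue analytically to it, and evaluation at each of its points is bounded.
The main step, `exists_extended_symbols`, moves the whole problem to this disk. The operator `W` and
its inverse `T` both satisfy `A(z^(j+k)) · A(1) = A(z^j) · A(z^k)`. Surjectivity then makes `A(1)`
zero-free, so `A(z^k) = σ^k · A(1)` with `σ = A(z)/A(1)`. Bounded evaluation gives `|σ(z)|^k ≤ C_z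
β(k)` for all `k`, hence `|σ(z)| ≤ R`, and the open mapping theorem makes this strict. By the
identity theorem the symbols of `W` and `T` are mutually inverse, so `φ` extends to an analytic
bijection `Φ` of `domain β`.

If `R = 1`, this is the claim. If `1 < R < ∞`, then `Φ` is an automorphism of a larger disk that
also preserves the unit disk, and the Schwarz lemma forces a rotation (`exists_rotation_of_mapsTo`).
If `R = ∞`, then `Φ(z) = az + b` (`exists_affine_of_entire_inverse`). The operator excludes `|a| <
1` (`one_le_norm_slope`), and preservation of the unit disk does the rest (`affine_eq_rotation`). -/

lemma norm_pow_div_sq_summable (β : WeightSequence) {r : ℝ} (hr0 : 0 ≤ r)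
    (hr : ENNReal.ofReal r < rootLiminf β) : Summable fun j => (r ^ j / β j) ^ 2 := by
  -- For `r < s < R`, eventually `s^j ≤ β j`, so the terms are dominated by powers of `(r/s)^2`.
  obtain ⟨s, hs0, hrs, hsR⟩ := ENNReal.lt_iff_exists_real_btwn.mp hr
  have hrs' : r < s := (ENNReal.ofReal_lt_ofReal_iff_of_nonneg hr0).mp hrs
  have hspos : 0 < s := hr0.trans_lt hrs'
  have hev := eventually_lt_of_lt_liminf hsR
  have hq : (r / s) ^ 2 < 1 := by
    have : r / s < 1 := (div_lt_one hspos).mpr hrs'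
    have : 0 ≤ r / s := by positivity
    nlinarith
  refine Summable.of_norm_bounded_eventually_nat
    (summable_geometric_of_lt_one (by positivity) hq) ?_
  filter_upwards [hev, eventually_gt_atTop 0] with j hj hj0
  have hb := β.pos j
  have h1 : s < β j ^ (1 / (j : ℝ)) := (ENNReal.ofReal_lt_ofReal_iff_of_nonneg hs0).mp hj
  have h2 : s ^ j ≤ β j := by
    have := pow_le_pow_left₀ hs0 h1.le j
    rwa [← Real.rpow_natCast (β j ^ _), ← Real.rpow_mul hb.le, one_div,
      inv_mul_cancel₀ (by exact_mod_cast hj0.ne'), Real.rpow_one] at this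
  rw [Real.norm_of_nonneg (by positivity), ← pow_mul, mul_comm, pow_mul]
  refine pow_le_pow_left₀ (by positivity) ?_ 2
  rw [div_pow]
  gcongr

/-- If `R < s < ‖z‖`, then `β j < s^j` for infinitely many `j`, and the hypothesis would bound
`(‖z‖/s)^j` by `A` along them. -/
lemma enorm_le_rootLiminf (β : WeightSequence) {z : ℂ} {A : ℝ}
    (h : ∀ j, ‖z‖ ^ j ≤ A * β j) : ‖z‖ₑ ≤ rootLiminf β := by
  by_contra! hlt
  obtain ⟨s, hs0, hRs, hsz⟩ := ENNReal.lt_iff_exists_real_btwn.mp hlt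
  have hspos : 0 < s := ENNReal.ofReal_pos.mp (bot_le.trans_lt hRs)
  have hsz' : s < ‖z‖ := by
    rw [← ofReal_norm] at hsz
    exact (ENNReal.ofReal_lt_ofReal_iff_of_nonneg hs0).mp hsz
  have hfr : ∃ᶠ j : ℕ in atTop, ENNReal.ofReal (β j ^ (1 / (j : ℝ))) < ENNReal.ofReal s :=
    frequently_lt_of_liminf_lt (by isBoundedDefault) hRs
  have htend := tendsto_pow_atTop_atTop_of_one_lt ((one_lt_div hspos).mpr hsz')
  have hev := (htend.eventually_gt_atTop A).and (eventually_gt_atTop 0)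
  obtain ⟨j, hj, hjA, hj0⟩ := (hfr.and_eventually hev).exists
  have hb := β.pos j
  have h1 : β j ^ (1 / (j : ℝ)) < s := (ENNReal.ofReal_lt_ofReal_iff hspos).mp hj
  have h2 : β j ≤ s ^ j := by
    have := pow_le_pow_left₀ (by positivity) h1.le j
    rwa [← Real.rpow_natCast (β j ^ _), ← Real.rpow_mul hb.le, one_div,
      inv_mul_cancel₀ (by exact_mod_cast hj0.ne'), Real.rpow_one] at this
  have hA : 0 < A := by
    by_contra! hA
    have h3 := h 0
    have h4 := β.pos 0
    simp only [pow_zero] at h3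
    nlinarith
  rw [div_pow, lt_div_iff₀ (by positivity)] at hjA
  have := h j
  nlinarith

end Radius

/-! ### Analytic extension, bounded evaluations and the `ℓ²` model. -/

namespace H2

variable {β : WeightSequence}

lemma norm_sq_eq_tsum (f : H2 β) : ‖f‖ ^ 2 = ∑' j, ‖coeff f j‖ ^ 2 * β j ^ 2 := by
  rw [@norm_sq_eq_re_inner ℂ]
  change RCLike.re (∑' j, conj (coeff f j) * coeff f j * (β j : ℂ) ^ 2) = _
  simp only [inner_term_self]
  rw [← Complex.ofReal_tsum]
  simp

lemma coeff_summable (f : H2 β) : Summable fun j => ‖coeff f j‖ ^ 2 * β j ^ 2 := f.2.2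

/-- A weighted arithmetic-geometric mean inequality that replaces Cauchy–Schwarz; the free parameter
`m` is later set to `‖f‖`, which makes the summed bound linear in `‖f‖`. -/
lemma mul_pow_le_add (β : WeightSequence) (x r m : ℝ) (hm : 0 < m) (j : ℕ) :
    x * r ^ j ≤ x ^ 2 * β j ^ 2 / m + m * (r ^ j / β j) ^ 2 := by
  have hb := β.pos j
  have h : x * r ^ j = (x * β j) * (r ^ j / β j) := by field_simp
  have h3 : x ^ 2 * β j ^ 2 / m + m * (r ^ j / β j) ^ 2 - (x * β j) * (r ^ j / β j) =
      (((x * β j) - m * (r ^ j / β j) / 2) ^ 2 + 3 / 4 * (m * (r ^ j / β j)) ^ 2) / m := by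
    field_simp
    ring
  have h4 : 0 ≤ (((x * β j) - m * (r ^ j / β j) / 2) ^ 2
      + 3 / 4 * (m * (r ^ j / β j)) ^ 2) / m := by positivity
  rw [h]
  linarith

lemma summable_norm_mul_pow {c : ℕ → ℂ} (hc : Summable fun j => ‖c j‖ ^ 2 * β j ^ 2) {r : ℝ}
    (hr0 : 0 ≤ r) (hr : ENNReal.ofReal r < rootLiminf β) : Summable fun j => ‖c j‖ * r ^ j := by
  refine Summable.of_nonneg_of_le (fun j => by positivity)
    (fun j => mul_pow_le_add β _ _ 1 one_pos j) ?_
  simpa using hc.add (norm_pow_div_sq_summable β hr0 hr)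

lemma rootLiminf_le_radius {c : ℕ → ℂ} (hc : Summable fun j => ‖c j‖ ^ 2 * β j ^ 2) :
    rootLiminf β ≤ (ofScalars ℂ c).radius := by
  refine ENNReal.le_of_forall_nnreal_lt fun r hr => ?_
  refine le_radius_of_summable_norm _ ?_
  simp only [ofScalars_norm]
  exact summable_norm_mul_pow hc r.2 (by simpa using hr)

lemma rootLiminf_pos (β : WeightSequence) : 0 < rootLiminf β :=
  one_pos.trans_le β.one_le_rootLiminf

/-- The common domain of the analytic extensions of the functions in `H²(β)`. -/
def domain (β : WeightSequence) : Set ℂ := Metric.eball 0 (rootLiminf β)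

lemma mem_domain {z : ℂ} : z ∈ domain β ↔ ‖z‖ₑ < rootLiminf β := by
  simp [domain, edist_eq_enorm_sub]

lemma isOpen_domain (β : WeightSequence) : IsOpen (domain β) := Metric.isOpen_eball

lemma isPreconnected_domain (β : WeightSequence) : IsPreconnected (domain β) :=
  (Metric.isConnected_eball (rootLiminf_pos β)).isPreconnected

lemma mem_domain_of_norm_lt_one {z : ℂ} (hz : ‖z‖ < 1) : z ∈ domain β := by
  rw [mem_domain, ← ofReal_norm]
  exact (ENNReal.ofReal_lt_one.mpr hz).trans_le β.one_le_rootLiminf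

lemma coe_mem_domain (z : 𝔻) : (z : ℂ) ∈ domain β := mem_domain_of_norm_lt_one z.norm_lt_one

lemma hasFPowerSeriesOnBall_ofScalarsSum {c : ℕ → ℂ}
    (hc : Summable fun j => ‖c j‖ ^ 2 * β j ^ 2) :
    HasFPowerSeriesOnBall (ofScalars ℂ c).sum (ofScalars ℂ c) 0 (rootLiminf β) :=
  ((ofScalars ℂ c).hasFPowerSeriesOnBall
    ((rootLiminf_pos β).trans_le (rootLiminf_le_radius hc))).mono (rootLiminf_pos β)
    (rootLiminf_le_radius hc)

/-- The analytic extension of a function in `H²(β)` to the disk of radius `liminf β(j)^{1/j}`. -/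
def extend (f : H2 β) : ℂ → ℂ := (ofScalars ℂ (coeff f)).sum

lemma extend_apply (f : H2 β) (z : ℂ) : extend f z = ∑' j, coeff f j * z ^ j := by
  have := congrFun (ofScalarsSum_eq_tsum (E := ℂ) (c := coeff f)) z
  simpa [ofScalarsSum, extend] using this

lemma hasFPowerSeriesOnBall_extend (f : H2 β) :
    HasFPowerSeriesOnBall (extend f) (ofScalars ℂ (coeff f)) 0 (rootLiminf β) :=
  hasFPowerSeriesOnBall_ofScalarsSum f.coeff_summable

lemma analyticOnNhd_extend (f : H2 β) : AnalyticOnNhd ℂ (extend f) (domain β) :=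
  (hasFPowerSeriesOnBall_extend f).analyticOnNhd

lemma extend_coe (f : H2 β) (z : 𝔻) : extend f z = f z := by
  have hz : (z : ℂ) ∈ Metric.ball (0 : ℂ) 1 := by simpa using z.norm_lt_one
  have hf : IsAnalyticOnDisk f := f.2.1
  have key := Complex.taylorSeries_eq_on_ball (r := 1) (by simpa [IsAnalyticOnDisk] using hf) hz
  rw [zeroExt_coe] at key
  rw [extend_apply, ← key]
  refine tsum_congr fun j => ?_
  simp [coeff]
  ring

lemma coeff_eq_of_hasFPowerSeriesAt {f : 𝔻 → ℂ} {c : ℕ → ℂ}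
    (h : HasFPowerSeriesAt (zeroExt f) (ofScalars ℂ c) 0) : coeff f = c := by
  have h2 := h.eq_formalMultilinearSeries h.analyticAt.hasFPowerSeriesAt
  rw [ofScalars_series_eq_iff] at h2
  rw [h2]
  rfl

/-- The function in `H²(β)` with prescribed Maclaurin coefficients. -/
def ofCoeff (c : ℕ → ℂ) (hc : Summable fun j => ‖c j‖ ^ 2 * β j ^ 2) : H2 β :=
  ⟨fun z => (ofScalars ℂ c).sum z, by
    have h1 := hasFPowerSeriesOnBall_ofScalarsSum hc
    have heq : Set.EqOn (zeroExt fun z => (ofScalars ℂ c).sum z) (ofScalars ℂ c).sum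
        (Metric.ball 0 1) := fun z hz => by
      have hz' : ‖z‖ < 1 := by simpa using hz
      exact zeroExt_coe _ (Complex.UnitDisc.mk z hz')
    refine ⟨(h1.differentiableOn.mono fun z hz => ?_).congr heq, ?_⟩
    · exact mem_domain_of_norm_lt_one (by simpa using hz)
    · have h2 := h1.hasFPowerSeriesAt.congr
        (heq.symm.eventuallyEq_of_mem (Metric.ball_mem_nhds 0 one_pos))
      rwa [coeff_eq_of_hasFPowerSeriesAt h2]⟩

lemma coeff_ofCoeff (c : ℕ → ℂ) (hc : Summable fun j => ‖c j‖ ^ 2 * β j ^ 2) :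
    coeff (ofCoeff c hc) = c := by
  have h1 := hasFPowerSeriesOnBall_ofScalarsSum hc
  have heq : Set.EqOn (zeroExt (ofCoeff c hc)) (ofScalars ℂ c).sum
      (Metric.ball 0 1) := fun z hz => by
    have hz' : ‖z‖ < 1 := by simpa using hz
    exact zeroExt_coe _ (Complex.UnitDisc.mk z hz')
  exact coeff_eq_of_hasFPowerSeriesAt (h1.hasFPowerSeriesAt.congr
        (heq.symm.eventuallyEq_of_mem (Metric.ball_mem_nhds 0 one_pos)))

lemma coeff_injective {f g : H2 β} (h : coeff f = coeff g) : f = g := by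
  refine DFunLike.coe_injective (funext fun z => ?_)
  rw [← extend_coe, ← extend_coe, extend, extend, h]

lemma exists_norm_extend_le {r : ℝ} (hr0 : 0 ≤ r) (hr : ENNReal.ofReal r < rootLiminf β) :
    ∃ C, ∀ (f : H2 β) (z : ℂ), ‖z‖ ≤ r → ‖extend f z‖ ≤ C * ‖f‖ := by
  refine ⟨1 + ∑' j, (r ^ j / β j) ^ 2, fun f z hz => ?_⟩
  rcases eq_or_ne f 0 with rfl | hf
  · rw [extend_apply]
    have : ∀ j, coeff (0 : H2 β) j = 0 := coeff_zero
    simp [this]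
  have hm : 0 < ‖f‖ := norm_pos_iff.mpr hf
  have hs := summable_norm_mul_pow f.coeff_summable hr0 hr
  have hS := norm_pow_div_sq_summable β hr0 hr
  have hle : ∀ j, ‖coeff f j * z ^ j‖ ≤ ‖coeff f j‖ * r ^ j := fun j => by
    rw [norm_mul, norm_pow]
    gcongr
  rw [extend_apply]
  have h1 : ‖∑' j, coeff f j * z ^ j‖ ≤ ∑' j, ‖coeff f j‖ * r ^ j :=
    tsum_of_norm_bounded hs.hasSum hle
  have hs2 := (f.coeff_summable.div_const ‖f‖).add (hS.mul_left ‖f‖)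
  have h2 := hs.tsum_le_tsum (fun j => mul_pow_le_add β ‖coeff f j‖ r ‖f‖ hm j) hs2
  rw [(f.coeff_summable.div_const ‖f‖).tsum_add (hS.mul_left ‖f‖), tsum_div_const, tsum_mul_left,
    ← norm_sq_eq_tsum] at h2
  refine h1.trans (h2.trans (le_of_eq ?_))
  field_simp

lemma extend_add (f g : H2 β) {z : ℂ} (hz : z ∈ domain β) :
    extend (f + g) z = extend f z + extend g z := by
  have h : Set.EqOn (extend (f + g)) (extend f + extend g) (domain β) := by
    refine (analyticOnNhd_extend _).eqOn_of_preconnected_of_eventuallyEq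
      ((analyticOnNhd_extend f).add (analyticOnNhd_extend g)) (isPreconnected_domain β)
      (mem_domain_of_norm_lt_one (z := 0) (by simp)) ?_
    filter_upwards [Metric.ball_mem_nhds (0 : ℂ) one_pos] with w hw
    have h1 := extend_coe (f + g) (.mk w (by simpa using hw))
    have h2 := extend_coe f (.mk w (by simpa using hw))
    have h3 := extend_coe g (.mk w (by simpa using hw))
    simp only [Complex.UnitDisc.coe_mk] at h1 h2 h3
    rw [Pi.add_apply, h1, h2, h3]
    rfl
  exact h hz

lemma extend_smul (c : ℂ) (f : H2 β) (z : ℂ) : extend (c • f) z = c * extend f z := by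
  simp only [extend_apply, ← tsum_mul_left]
  refine tsum_congr fun j => ?_
  rw [coe_smul, coeff_smul, mul_assoc]

/-- Evaluation of the analytic extension at a point of the domain. -/
def evalCLM (z : ℂ) (hz : z ∈ domain β) : H2 β →L[ℂ] ℂ :=
  LinearMap.mkContinuousOfExistsBound
    { toFun := fun f => extend f z
      map_add' := fun f g => extend_add f g hz
      map_smul' := fun c f => extend_smul c f z }
    (by
      obtain ⟨C, hC⟩ := exists_norm_extend_le (β := β) (norm_nonneg z)
        (by rw [ofReal_norm]; exact mem_domain.mp hz)
      exact ⟨C, fun f => hC f z le_rfl⟩)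

lemma evalCLM_apply (z : ℂ) (hz : z ∈ domain β) (f : H2 β) : evalCLM z hz f = extend f z := rfl

/-- The monomial `z ↦ z ^ k` as an element of `H²(β)`. -/
def monomial (β : WeightSequence) (k : ℕ) : H2 β :=
  ofCoeff (Pi.single k 1) (summable_of_ne_finset_zero (s := {k}) fun j hj => by
    simp [Pi.single_eq_of_ne (by simpa using hj : j ≠ k)])

lemma coeff_monomial (k : ℕ) : coeff (monomial β k) = Pi.single k 1 := coeff_ofCoeff _ _

lemma extend_monomial (k : ℕ) (z : ℂ) : extend (monomial β k) z = z ^ k := by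
  rw [extend_apply, coeff_monomial, tsum_eq_single k fun j hj => by simp [hj]]
  simp

lemma norm_monomial (k : ℕ) : ‖monomial β k‖ = β k := by
  have h := norm_sq_eq_tsum (monomial β k)
  rw [coeff_monomial, tsum_eq_single k fun j hj => by simp [hj]] at h
  have hb := β.pos k
  simp only [Pi.single_eq_same, norm_one, one_pow, one_mul] at h
  exact (sq_eq_sq₀ (norm_nonneg _) hb.le).mp h

/-- The isometry of `H²(β)` onto `ℓ²` sending `f` to `(f̂(j) β(j))`. -/
def equivLp (β : WeightSequence) : H2 β ≃ₗᵢ[ℂ] lp (fun _ : ℕ => ℂ) 2 where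
  toFun f := ⟨fun j => coeff f j * (β j : ℂ), (memℓp_gen_iff (by simp)).mpr (by
    simpa [mul_pow] using f.coeff_summable)⟩
  map_add' f g := by
    ext j
    change coeff (⇑f + ⇑g) j * _ = coeff f j * _ + coeff g j * _
    rw [coeff_add (f := ⇑f) (g := ⇑g) f.2.1 g.2.1, add_mul]
  map_smul' c f := by
    ext j
    change coeff (c • ⇑f) j * _ = c * (coeff f j * _)
    rw [coeff_smul, mul_assoc]
  invFun a := ofCoeff (fun j => a j / (β j : ℂ)) (by
    have h := (memℓp_gen_iff (by simp)).mp a.2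
    refine h.congr fun j => ?_
    have hb := (β.pos j).ne'
    simp [div_pow]
    field_simp)
  left_inv f := by
    refine coeff_injective ?_
    rw [coeff_ofCoeff]
    funext j
    have hb : (β j : ℂ) ≠ 0 := by exact_mod_cast (β.pos j).ne'
    field_simp
  right_inv a := by
    ext j
    have hb : (β j : ℂ) ≠ 0 := by exact_mod_cast (β.pos j).ne'
    change coeff (ofCoeff _ _) j * (β j : ℂ) = a j
    rw [coeff_ofCoeff]
    field_simp
  norm_map' f := by
    rw [← sq_eq_sq₀ (norm_nonneg _) (norm_nonneg _), norm_sq_eq_tsum]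
    have h := lp.norm_rpow_eq_tsum (p := 2) (E := fun _ : ℕ => ℂ) (by simp)
      ⟨fun j => coeff f j * (β j : ℂ), (memℓp_gen_iff (by simp)).mpr (by
        simpa [mul_pow] using f.coeff_summable)⟩
    simpa [mul_pow] using h

-- Completeness is what makes the inverse of a bounded bijection bounded.
instance : CompleteSpace (H2 β) :=
  (equivLp β).isometry.isUniformInducing.completeSpace_congr (equivLp β).surjective |>.mpr
    inferInstance

lemma equivLp_apply (f : H2 β) (j : ℕ) : equivLp β f j = coeff f j * (β j : ℂ) := rfl

lemma equivLp_monomial (k : ℕ) :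
    equivLp β (monomial β k) = lp.single 2 k (β k : ℂ) := by
  ext j
  rw [equivLp_apply, coeff_monomial, lp.single_apply]
  rcases eq_or_ne j k with rfl | h <;> simp [*]

lemma hasSum_monomial (f : H2 β) : HasSum (fun k => coeff f k • monomial β k) f := by
  have h : HasSum (fun k => equivLp β (coeff f k • monomial β k)) (equivLp β f) := by
    refine (lp.hasSum_single (p := 2) (by simp) (equivLp β f)).congr_fun fun k => ?_
    rw [map_smul, equivLp_monomial, ← lp.single_smul]
    rfl
  exact (equivLp β).toContinuousLinearEquiv.hasSum'.mp h

end H2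

end WeightedHardy

end

/-! ### Symbols of multiplicative operators and their extension to the common domain. -/

noncomputable section

namespace WeightedHardy

namespace H2

variable {β : WeightSequence}

/-- Monomials span a dense subspace and evaluation is continuous, so otherwise the whole range of
`T`, including the constant `1`, would vanish at `z`. -/
lemma exists_extend_monomial_ne_zero {T : H2 β →L[ℂ] H2 β} (hT : Function.Surjective T) {z : ℂ}
    (hz : z ∈ domain β) : ∃ k, extend (T (monomial β k)) z ≠ 0 := by
  by_contra! h
  obtain ⟨f, hf⟩ := hT (monomial β 0)
  have h1 := (hasSum_monomial f).mapL ((evalCLM z hz).comp T)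
  simp only [map_smul, ContinuousLinearMap.comp_apply, evalCLM_apply, h, smul_zero, hf,
    extend_monomial, pow_zero] at h1
  exact zero_ne_one (hasSum_zero.unique h1)

section Multiplicative

variable {T : H2 β →L[ℂ] H2 β} (hT : Function.Surjective T)
  (hmul : ∀ j k : ℕ, ∀ z ∈ domain β,
    extend (T (monomial β (j + k))) z * extend (T (monomial β 0)) z =
      extend (T (monomial β j)) z * extend (T (monomial β k)) z)

/-- The symbol `T z / T 1` of an operator `T` on `H²(β)`. -/
def symbol (T : H2 β →L[ℂ] H2 β) (z : ℂ) : ℂ :=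
  extend (T (monomial β 1)) z / extend (T (monomial β 0)) z

include hT hmul

/-- At a zero of `T 1`, the relation with `j = k` makes the square of every `T z^k` vanish. -/
lemma extend_map_one_ne_zero {z : ℂ} (hz : z ∈ domain β) :
    extend (T (monomial β 0)) z ≠ 0 := by
  intro h0
  obtain ⟨k, hk⟩ := exists_extend_monomial_ne_zero hT hz
  have h := hmul k k z hz
  rw [h0, mul_zero] at h
  exact hk (mul_self_eq_zero.mp h.symm)

lemma analyticOnNhd_symbol : AnalyticOnNhd ℂ (symbol T) (domain β) :=
  (analyticOnNhd_extend _).div (analyticOnNhd_extend _)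
    fun _ hz => extend_map_one_ne_zero hT hmul hz

lemma extend_map_monomial (k : ℕ) {z : ℂ} (hz : z ∈ domain β) :
    extend (T (monomial β k)) z = symbol T z ^ k * extend (T (monomial β 0)) z := by
  have h0 := extend_map_one_ne_zero hT hmul hz
  induction k with
  | zero => simp
  | succ k ih =>
    refine mul_right_cancel₀ h0 ?_
    have h1 : symbol T z * extend (T (monomial β 0)) z = extend (T (monomial β 1)) z :=
      div_mul_cancel₀ _ h0
    rw [hmul k 1 z hz, ih, ← h1]
    ring

/-- The monomial `z^k` has norm `β k`, so bounded evaluation of `T z^k = σ^k · T 1` compares powers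
of `σ(z)` with the weights. -/
lemma enorm_symbol_le {z : ℂ} (hz : z ∈ domain β) : ‖symbol T z‖ₑ ≤ rootLiminf β := by
  have h0 := norm_pos_iff.mpr (extend_map_one_ne_zero hT hmul hz)
  set S := (evalCLM z hz).comp T
  refine enorm_le_rootLiminf β (A := ‖S‖ / ‖extend (T (monomial β 0)) z‖) fun k => ?_
  have h1 : ‖extend (T (monomial β k)) z‖ ≤ ‖S‖ * β k := by
    rw [← norm_monomial]
    exact S.le_opNorm _
  rw [extend_map_monomial hT hmul k hz, norm_mul, norm_pow] at h1
  rw [div_mul_eq_mul_div, le_div_iff₀ h0]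
  exact h1

lemma symbol_mapsTo (hne : ∃ z ∈ domain β, ∃ w ∈ domain β, symbol T z ≠ symbol T w) :
    Set.MapsTo (symbol T) (domain β) (domain β) := by
  intro z hz
  rw [mem_domain]
  rcases eq_or_ne (rootLiminf β) ⊤ with htop | htop
  · rw [htop]
    exact enorm_lt_top
  -- The bound on the symbol only gives the closed disk; an open image avoids its boundary circle.
  have hopen : IsOpen (symbol T '' domain β) := by
    refine ((analyticOnNhd_symbol hT hmul).is_constant_or_isOpen
      (isPreconnected_domain β)).resolve_left ?_ _ subset_rfl (isOpen_domain β)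
    rintro ⟨c, hc⟩
    obtain ⟨z, hz, w, hw, h⟩ := hne
    exact h ((hc z hz).trans (hc w hw).symm)
  lift rootLiminf β to NNReal using htop with r hr
  have hr0 : (r : ℝ) ≠ 0 := by
    have := rootLiminf_pos β
    rw [← hr] at this
    exact_mod_cast this.ne'
  have hsub : symbol T '' domain β ⊆ Metric.closedBall 0 r := by
    rintro _ ⟨w, hw, rfl⟩
    have h := enorm_symbol_le hT hmul hw
    rw [← hr, enorm_le_coe] at h
    rw [mem_closedBall_zero_iff]
    exact_mod_cast h
  have h := interior_maximal hsub hopen ⟨z, hz, rfl⟩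
  rw [interior_closedBall _ hr0] at h
  rw [enorm_lt_coe]
  rw [mem_ball_zero_iff] at h
  exact_mod_cast h

end Multiplicative

lemma eqOn_domain_of_eq_on_disk {F G : ℂ → ℂ} (hF : AnalyticOnNhd ℂ F (domain β))
    (hG : AnalyticOnNhd ℂ G (domain β)) (h : ∀ z : 𝔻, F z = G z) :
    Set.EqOn F G (domain β) := by
  refine hF.eqOn_of_preconnected_of_eventuallyEq hG (isPreconnected_domain β)
    (mem_domain_of_norm_lt_one (z := 0) (by simp)) ?_
  filter_upwards [Metric.ball_mem_nhds (0 : ℂ) one_pos] with w hw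
  exact h (.mk w (by simpa using hw))

/-- Injectivity keeps `φ w` away from `φ 0` for `w ≠ 0`, so `φ 0` is an accumulation point of the
range and the identity theorem applies. This serves the inverse operator, whose values are known
only along `φ`. -/
lemma eqOn_domain_of_eq_on_range {F G : ℂ → ℂ} (hF : AnalyticOnNhd ℂ F (domain β))
    (hG : AnalyticOnNhd ℂ G (domain β)) {φ : 𝔻 → 𝔻} (hφ : IsAnalyticSelfmap φ)
    (hinj : Function.Injective φ) (h : ∀ z : 𝔻, F (φ z) = G (φ z)) :
    Set.EqOn F G (domain β) := by
  refine hF.eqOn_of_preconnected_of_frequently_eq hG (isPreconnected_domain β)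
    (coe_mem_domain (φ 0)) ?_
  have hball : Metric.ball (0 : ℂ) 1 ∈ 𝓝 (0 : ℂ) := Metric.ball_mem_nhds 0 one_pos
  set Φ := zeroExt fun z => (φ z : ℂ)
  have hΦ : ∀ z : 𝔻, Φ z = φ z := fun z => zeroExt_coe _ z
  have hcont : Tendsto Φ (𝓝 0) (𝓝 (φ 0)) := by
    have h1 := (hφ.differentiableAt hball).continuousAt.tendsto
    have h2 := hΦ 0
    rw [Complex.UnitDisc.coe_zero] at h2
    change Tendsto Φ (𝓝 0) (𝓝 (Φ 0)) at h1
    rwa [h2] at h1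
  have htend : Tendsto Φ (𝓝[≠] 0) (𝓝[≠] (φ 0 : ℂ)) := by
    refine tendsto_nhdsWithin_iff.mpr ⟨hcont.mono_left nhdsWithin_le_nhds, ?_⟩
    filter_upwards [self_mem_nhdsWithin, nhdsWithin_le_nhds hball] with w hw0 hw heq
    have h1 := hΦ (.mk w (by simpa using hw))
    rw [Complex.UnitDisc.coe_mk] at h1
    have h2 := hinj (Complex.UnitDisc.coe_injective (h1.symm.trans heq))
    exact hw0 (by simpa using congrArg ((↑) : 𝔻 → ℂ) h2)
  refine htend.frequently (Eventually.frequently ?_)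
  filter_upwards [nhdsWithin_le_nhds hball] with w hw
  have h1 := hΦ (.mk w (by simpa using hw))
  rw [Complex.UnitDisc.coe_mk] at h1
  rw [h1]
  exact h _

end H2

open H2

/-- An invertible weighted composition operator on `H²(β)` extends to one over the common domain
of analytic extensions, whose composition symbol is a bijection of that domain. -/
theorem exists_extended_symbols {β : WeightSequence} {ψ : 𝔻 → ℂ} {φ : 𝔻 → 𝔻}
    (hφ : IsAnalyticSelfmap φ) {W : H2 β →L[ℂ] H2 β}
    (hW : ∀ f : H2 β, ⇑(W f) = weightedComp ψ φ ⇑f) (hinv : Function.Bijective W) :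
    ∃ Φ χ Ψ : ℂ → ℂ, AnalyticOnNhd ℂ Φ (domain β) ∧ AnalyticOnNhd ℂ χ (domain β) ∧
      Set.MapsTo Φ (domain β) (domain β) ∧ Set.MapsTo χ (domain β) (domain β) ∧
      (∀ z ∈ domain β, χ (Φ z) = z) ∧ (∀ z ∈ domain β, Φ (χ z) = z) ∧
      (∀ z : 𝔻, Φ z = φ z) ∧ (∀ z ∈ domain β, Ψ z ≠ 0) ∧
      ∀ f : H2 β, ∀ z ∈ domain β, extend (W f) z = Ψ z * extend f (Φ z) := by
  have hWz : ∀ (f : H2 β) (z : 𝔻), extend (W f) z = ψ z * extend f (φ z) := fun f z => by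
    rw [extend_coe, extend_coe, hW]
    rfl
  let e := ContinuousLinearEquiv.ofBijective W (LinearMap.ker_eq_bot.mpr hinv.1)
    (LinearMap.range_eq_top.mpr hinv.2)
  let T : H2 β →L[ℂ] H2 β := e.symm
  have hWT : ∀ f, W (T f) = f := fun f => e.apply_symm_apply f
  have hT : Function.Surjective T := e.symm.surjective
  have hTz : ∀ (f : H2 β) (z : 𝔻), ψ z * extend (T f) (φ z) = extend f z := fun f z => by
    rw [← hWz, hWT]
  have hψ0 : ∀ z, ψ z ≠ 0 := fun z h => by
    have := hTz (monomial β 0) z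
    simp [h, extend_monomial] at this
  have hinj : Function.Injective φ := fun z w h => by
    have h0 := hTz (monomial β 0) z
    have h0' := hTz (monomial β 0) w
    have h1 := hTz (monomial β 1) z
    have h1' := hTz (monomial β 1) w
    simp only [extend_monomial, pow_zero, pow_one] at h0 h0' h1 h1'
    rw [← h] at h0' h1'
    have hne : extend (T (monomial β 0)) (φ z) ≠ 0 := right_ne_zero_of_mul_eq_one h0
    -- Since `ψ · (T 1 ∘ φ) = 1`, points with the same image under `φ` share the value of `ψ`; then
    -- `ψ · (T z ∘ φ) = z` separates them.
    have hψ : ψ z = ψ w := mul_right_cancel₀ hne (h0.trans h0'.symm)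
    rw [hψ] at h1
    exact Complex.UnitDisc.coe_injective (h1.symm.trans h1')
  have hmulW : ∀ j k : ℕ, ∀ z ∈ domain β,
      extend (W (monomial β (j + k))) z * extend (W (monomial β 0)) z =
        extend (W (monomial β j)) z * extend (W (monomial β k)) z := fun j k z hz => by
    refine eqOn_domain_of_eq_on_disk
      ((analyticOnNhd_extend _).mul (analyticOnNhd_extend _))
      ((analyticOnNhd_extend _).mul (analyticOnNhd_extend _)) (fun z => ?_) hz
    simp only [hWz, extend_monomial]
    ring
  have hmulT : ∀ j k : ℕ, ∀ z ∈ domain β,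
      extend (T (monomial β (j + k))) z * extend (T (monomial β 0)) z =
        extend (T (monomial β j)) z * extend (T (monomial β k)) z := fun j k z hz => by
    refine eqOn_domain_of_eq_on_range
      ((analyticOnNhd_extend _).mul (analyticOnNhd_extend _))
      ((analyticOnNhd_extend _).mul (analyticOnNhd_extend _)) hφ hinj (fun z => ?_) hz
    have hT' : ∀ i, extend (T (monomial β i)) (φ z) = (z : ℂ) ^ i / ψ z := fun i => by
      rw [eq_div_iff (hψ0 z), mul_comm, hTz, extend_monomial]
    simp only [hT']
    have := hψ0 z
    field_simp
    exact pow_add _ _ _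
  have hΦ : ∀ z : 𝔻, symbol W z = φ z := fun z => by
    rw [symbol, hWz, hWz, extend_monomial, extend_monomial]
    have := hψ0 z
    field_simp
  have hχ : ∀ z : 𝔻, symbol T (φ z) = z := fun z => by
    have h0 := hTz (monomial β 0) z
    have h1 := hTz (monomial β 1) z
    rw [extend_monomial, pow_zero] at h0
    rw [extend_monomial, pow_one] at h1
    rw [symbol, div_eq_iff (right_ne_zero_of_mul_eq_one h0), ← h1]
    linear_combination -(extend (T (monomial β 1)) (φ z)) * h0
  obtain ⟨z₁, hz₁⟩ : ∃ z : 𝔻, z ≠ 0 :=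
    ⟨.mk (1 / 2) (by norm_num), by rw [Ne, Complex.UnitDisc.mk_eq_zero]; norm_num⟩
  have hmapsW := symbol_mapsTo hinv.2 hmulW ⟨z₁, coe_mem_domain _, (0 : 𝔻), coe_mem_domain _, by
    rw [hΦ, hΦ]
    exact fun h => hz₁ (hinj (Complex.UnitDisc.coe_injective h))⟩
  have hmapsT := symbol_mapsTo hT hmulT
    ⟨φ z₁, coe_mem_domain _, φ 0, coe_mem_domain _, by
      rw [hχ, hχ]
      exact fun h => hz₁ (Complex.UnitDisc.coe_injective h)⟩
  have hanW := analyticOnNhd_symbol hinv.2 hmulW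
  have hanT := analyticOnNhd_symbol hT hmulT
  refine ⟨symbol W, symbol T, extend (W (monomial β 0)), hanW, hanT, hmapsW, hmapsT, ?_, ?_, hΦ,
    fun z hz => extend_map_one_ne_zero hinv.2 hmulW hz, ?_⟩
  · refine eqOn_domain_of_eq_on_disk (hanT.comp hanW hmapsW) analyticOnNhd_id fun z => ?_
    simp only [hΦ, hχ]
  · refine eqOn_domain_of_eq_on_range (hanW.comp hanT hmapsT) analyticOnNhd_id hφ hinj
      fun z => ?_
    simp only [hΦ, hχ]
  · intro f
    refine eqOn_domain_of_eq_on_disk (analyticOnNhd_extend _) ((analyticOnNhd_extend _).mul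
      ((analyticOnNhd_extend f).comp hanW hmapsW)) fun z => ?_
    simp [hΦ, hWz, extend_monomial]

end WeightedHardy

end

/-! ### Rigidity of analytic bijections of the plane and of disks. -/

noncomputable section

namespace WeightedHardy

open Metric Set

/-- An entire function with an entire inverse is affine. -/
lemma exists_affine_of_entire_inverse {Φ χ : ℂ → ℂ} (hΦ : Differentiable ℂ Φ)
    (hχ : Differentiable ℂ χ) (hl : ∀ z, χ (Φ z) = z) :
    ∃ a b : ℂ, a ≠ 0 ∧ ∀ z, Φ z = a * z + b := by
  have hinj : Function.Injective Φ := Function.LeftInverse.injective hl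
  have hdiv : ∀ z, z ≠ 0 → dslope Φ 0 z = (Φ z - Φ 0) / z := fun z hz => by
    rw [dslope_of_ne _ hz, slope_def_field, sub_zero]
  have hne : ∀ z, dslope Φ 0 z ≠ 0 := fun z => by
    rcases eq_or_ne z 0 with rfl | hz
    · rw [dslope_same]
      intro h0
      have h1 := ((hχ (Φ 0)).hasDerivAt.comp (0 : ℂ) (hΦ 0).hasDerivAt).deriv
      have h2 : χ ∘ Φ = id := funext hl
      rw [h2, h0, mul_zero, deriv_id] at h1
      exact one_ne_zero h1
    · rw [hdiv z hz]
      exact div_ne_zero (sub_ne_zero.mpr fun h => hz (hinj h)) hz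
  have hdΦ : Differentiable ℂ (dslope Φ 0) :=
    differentiableOn_univ.mp
      ((Complex.differentiableOn_dslope univ_mem).mpr hΦ.differentiableOn)
  -- The reciprocal difference quotient is entire and zero-free. Continuity of `χ` makes `Φ` proper,
  -- so `G` grows at most linearly and Liouville makes it affine; being zero-free, it is constant.
  set G : ℂ → ℂ := fun z => (dslope Φ 0 z)⁻¹ with hG
  have hGd : Differentiable ℂ G := fun z => (hdΦ z).inv (hne z)
  have hGne : ∀ z, G z ≠ 0 := fun z => inv_ne_zero (hne z)
  obtain ⟨M, hM⟩ := (isCompact_closedBall (Φ 0) 1).exists_bound_of_continuousOn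
    hχ.continuous.continuousOn
  have hGle : ∀ z, M < ‖z‖ → ‖G z‖ ≤ ‖z‖ := fun z hz => by
    have hz0 : z ≠ 0 := by
      rintro rfl
      have := hM (Φ 0) (mem_closedBall_self zero_le_one)
      rw [hl] at this
      exact absurd hz this.not_gt
    have h1 : 1 < ‖Φ z - Φ 0‖ := by
      by_contra! h
      have := hM (Φ z) (by rwa [mem_closedBall, dist_eq_norm])
      rw [hl] at this
      exact absurd hz this.not_gt
    rw [hG]
    simp only
    rw [hdiv z hz0, inv_div, norm_div]
    exact div_le_self (norm_nonneg _) h1.le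
  have hdG : Differentiable ℂ (dslope G 0) :=
    differentiableOn_univ.mp
      ((Complex.differentiableOn_dslope univ_mem).mpr hGd.differentiableOn)
  obtain ⟨N, hN⟩ := (isCompact_closedBall (0 : ℂ) (max M 1)).exists_bound_of_continuousOn
    hdG.continuous.continuousOn
  have hbdd : Bornology.IsBounded (range (dslope G 0)) := by
    refine isBounded_iff_forall_norm_le.mpr ⟨max N (1 + ‖G 0‖), ?_⟩
    rintro _ ⟨z, rfl⟩
    rcases le_or_gt ‖z‖ (max M 1) with hz | hz
    · exact (hN z (by simpa using hz)).trans (le_max_left _ _)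
    · have hz1 : 1 < ‖z‖ := (le_max_right _ _).trans_lt hz
      have hz0 : z ≠ 0 := norm_pos_iff.mp (one_pos.trans hz1)
      refine le_trans ?_ (le_max_right _ _)
      rw [dslope_of_ne _ hz0, slope_def_field, sub_zero, norm_div, div_le_iff₀ (one_pos.trans hz1)]
      have h1 := hGle z ((le_max_left _ _).trans_lt hz)
      have h2 := norm_sub_le (G z) (G 0)
      nlinarith [norm_nonneg (G 0)]
  have hlin : ∀ z, G z = G 0 + z * dslope G 0 0 := fun z => by
    have h1 := sub_smul_dslope G 0 z
    rw [hdG.apply_eq_apply_of_bounded hbdd z 0, sub_zero, smul_eq_mul] at h1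
    rw [h1]
    ring
  have hd0 : dslope G 0 0 = 0 := by
    by_contra h
    refine hGne (-(G 0) / dslope G 0 0) ?_
    rw [hlin]
    field_simp
    ring
  refine ⟨dslope Φ 0 0, Φ 0, hne 0, fun z => ?_⟩
  have h1 := sub_smul_dslope Φ 0 z
  have h2 : dslope Φ 0 z = dslope Φ 0 0 := by
    have := hlin z
    rw [hd0, mul_zero, add_zero] at this
    exact inv_injective this
  rw [h2, sub_zero, smul_eq_mul] at h1
  linear_combination -h1

/-- A biholomorphic selfmap of a disk of radius greater than one that maps the unit disk into
itself is a rotation. -/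
lemma exists_rotation_of_mapsTo {R : ℝ} (hR : 1 < R) {Φ χ : ℂ → ℂ}
    (hΦ : DifferentiableOn ℂ Φ (ball 0 R)) (hχ : DifferentiableOn ℂ χ (ball 0 R))
    (hΦm : MapsTo Φ (ball 0 R) (ball 0 R)) (hχm : MapsTo χ (ball 0 R) (ball 0 R))
    (hl : ∀ z ∈ ball 0 R, χ (Φ z) = z) (hr : ∀ z ∈ ball 0 R, Φ (χ z) = z)
    (hdisk : MapsTo Φ (ball 0 1) (ball 0 1)) :
    ∃ ζ : ℂ, ‖ζ‖ = 1 ∧ ∀ z ∈ ball 0 R, Φ z = ζ * z := by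
  have hR0 : 0 < R := one_pos.trans hR
  have h0R : (0 : ℂ) ∈ ball 0 R := mem_ball_self hR0
  have hsub : closedBall (0 : ℂ) 1 ⊆ ball 0 R := closedBall_subset_ball hR
  have hclosed : MapsTo Φ (closedBall 0 1) (closedBall 0 1) := by
    have h := hdisk.closure_of_continuousOn (hΦ.continuousOn.mono (by
      rwa [closure_ball _ one_ne_zero]))
    rwa [closure_ball _ one_ne_zero] at h
  set b := Φ 0 with hb
  have hbR : ‖b‖ < R := by simpa using hΦm h0R
  -- The automorphism of the disk of radius `R` exchanging `0` and `b`, so that `χ ∘ S` fixes `0`.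
  set S : ℂ → ℂ := fun z => R ^ 2 * (b - z) / (R ^ 2 - conj b * z) with hS
  have hSlt : ∀ z : ℂ, ‖z‖ < R →
      ‖(R : ℂ) * (b - z)‖ < ‖(R : ℂ) ^ 2 - conj b * z‖ := fun z hz => by
    -- The difference of the squares is `(R² - |b|²)(R² - |z|²)`.
    refine lt_of_pow_lt_pow_left₀ 2 (norm_nonneg _) ?_
    have hb2 : ‖b‖ ^ 2 < R ^ 2 := by gcongr
    have hz2 : ‖z‖ ^ 2 < R ^ 2 := by gcongr
    have h1 := mul_pos (sub_pos.mpr hb2) (sub_pos.mpr hz2)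
    simp only [← Complex.normSq_eq_norm_sq, Complex.normSq_apply] at h1 ⊢
    simp [pow_two] at h1 ⊢
    nlinarith
  have hSne : ∀ z : ℂ, ‖z‖ < R → (R : ℂ) ^ 2 - conj b * z ≠ 0 := fun z hz =>
    norm_pos_iff.mp ((norm_nonneg _).trans_lt (hSlt z hz))
  have hSm : MapsTo S (ball 0 R) (ball 0 R) := fun z hz => by
    rw [mem_ball_zero_iff] at hz ⊢
    have h1 := hSlt z hz
    rw [hS]
    simp only
    rw [norm_div, div_lt_iff₀ (norm_pos_iff.mpr (hSne z hz)), pow_two, mul_assoc, norm_mul,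
      Complex.norm_real, Real.norm_of_nonneg hR0.le, ← pow_two]
    gcongr
  have hSd : DifferentiableOn ℂ S (ball 0 R) := fun z hz => by
    refine DifferentiableAt.differentiableWithinAt ?_
    have := hSne z (by simpa using hz)
    fun_prop (disch := assumption)
  have hb0 : b = 0 := by
    by_contra hb0
    have hbpos : 0 < ‖b‖ := norm_pos_iff.mpr hb0
    have hbc : (‖b‖ : ℂ) ≠ 0 := by exact_mod_cast hbpos.ne'
    have hRc : (R : ℂ) ≠ 0 := by exact_mod_cast hR0.ne'
    -- The point of the unit circle opposite to `b`. Schwarz puts `χ (S w)` in the closed unit disk,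
    -- hence also `S w = Φ (χ (S w))`; but `|S w| = R²(|b| + 1)/(R² + |b|) > 1`.
    set w : ℂ := -b / ‖b‖ with hw
    have hwn : ‖w‖ = 1 := by
      rw [hw, norm_div, norm_neg, Complex.norm_real, norm_norm, div_self hbpos.ne']
    have hwR : ‖w‖ < R := hwn ▸ hR
    have h1 : ‖(χ ∘ S) w‖ ≤ ‖w‖ := by
      refine Complex.norm_le_norm_of_mapsTo_ball (hχ.comp hSd hSm)
        ((hχm.comp hSm).mono_right ball_subset_closedBall) ?_ hwR
      have : S 0 = b := by simp [hS, hRc]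
      rw [Function.comp_apply, this, hb, hl 0 h0R]
    have h2 := hclosed (by simpa [hwn] using h1 : χ (S w) ∈ closedBall (0 : ℂ) 1)
    rw [hr _ (hSm (by simpa using hwR)), mem_closedBall_zero_iff] at h2
    have h3 : S w = ((R ^ 2 * (‖b‖ + 1) / (R ^ 2 + ‖b‖) : ℝ) : ℂ) * (b / ‖b‖) := by
      have hcw : conj b * w = -‖b‖ := by
        rw [hw, mul_div_assoc', mul_neg, Complex.conj_mul']
        field_simp
      have hbw : b - w = (‖b‖ + 1) * (b / ‖b‖) := by
        rw [hw]
        field_simp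
        ring
      simp only [hS]
      rw [hcw, hbw]
      push_cast
      ring
    rw [h3, norm_mul, norm_div, Complex.norm_real, Complex.norm_real, norm_norm,
      div_self hbpos.ne', mul_one, Real.norm_of_nonneg (by positivity),
      div_le_one (by positivity)] at h2
    nlinarith [mul_pos hbpos (sub_pos.mpr hR), mul_pos (mul_pos hbpos (sub_pos.mpr hR)) hR0]
  have h1R : (1 : ℂ) ∈ ball 0 R := by simpa using hR
  have hle : ‖Φ 1‖ ≤ 1 := by
    simpa using hclosed (by simp : (1 : ℂ) ∈ closedBall 0 1)
  -- Schwarz for `χ` at `Φ 1`; together with `hle` it gives equality in the Schwarz lemma for `Φ` at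
  -- the point `1`.
  have hge : 1 ≤ ‖Φ 1‖ := by
    have h0 : χ 0 = 0 := by simpa only [← hb, hb0] using hl 0 h0R
    have := Complex.norm_le_norm_of_mapsTo_ball hχ (hχm.mono_right ball_subset_closedBall)
      h0 (by simpa using hΦm h1R)
    rwa [hl 1 h1R, norm_one] at this
  obtain ⟨ζ, hζ, h⟩ := Complex.affine_of_mapsTo_ball_of_exists_norm_dslope_eq_div' hΦ
    (c := 0) (R₂ := R) (by
      rw [← hb, hb0]
      exact hΦm.mono_right ball_subset_closedBall) ⟨1, h1R, by
      rw [dslope_of_ne _ one_ne_zero, slope_def_field, ← hb, hb0, div_self hR0.ne']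
      simpa using le_antisymm hle hge⟩
  refine ⟨ζ, by rw [hζ, div_self hR0.ne'], fun z hz => ?_⟩
  rw [h hz]
  simp only [← hb, hb0, zero_add, sub_zero, smul_eq_mul, mul_comm]

/-- An affine map with slope of modulus at least one that maps the unit disk into itself is a
rotation. -/
lemma affine_eq_rotation {a b : ℂ} (ha : 1 ≤ ‖a‖)
    (h : MapsTo (fun z => a * z + b) (ball 0 1) (ball 0 1)) : ‖a‖ = 1 ∧ b = 0 := by
  have ha0 : a ≠ 0 := norm_pos_iff.mp (one_pos.trans_le ha)
  have hac : (‖a‖ : ℂ) ≠ 0 := by exact_mod_cast (norm_pos_iff.mpr ha0).ne'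
  have hclosed : MapsTo (fun z => a * z + b) (closedBall 0 1) (closedBall 0 1) := by
    have h := h.closure (by fun_prop)
    rwa [closure_ball _ one_ne_zero] at h
  have key : ‖a‖ + ‖b‖ ≤ 1 := by
    rcases eq_or_ne b 0 with rfl | hb
    · simpa using hclosed (by simp : (1 : ℂ) ∈ closedBall 0 1)
    · have hbn := (norm_pos_iff.mpr hb).ne'
      have han := (norm_pos_iff.mpr ha0).ne'
      have hbc : (‖b‖ : ℂ) ≠ 0 := by exact_mod_cast hbn
      -- The unimodular point at which `a * z` has the direction of `b`, so that the moduli add.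
      have h1 := hclosed (x := b / a * (‖a‖ / ‖b‖)) (by
        rw [mem_closedBall_zero_iff, norm_mul, norm_div, norm_div, Complex.norm_real,
          Complex.norm_real, norm_norm, norm_norm]
        field_simp
        exact le_rfl)
      have h2 : a * (b / a * (‖a‖ / ‖b‖)) + b = ((‖a‖ + ‖b‖ : ℝ) : ℂ) * (b / ‖b‖) := by
        push_cast
        field_simp
      simp only [h2] at h1
      rw [mem_closedBall_zero_iff, norm_mul, norm_div, Complex.norm_real, Complex.norm_real,
        norm_norm, div_self hbn, mul_one, Real.norm_of_nonneg (by positivity)] at h1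
      exact h1
  have := norm_nonneg b
  exact ⟨by linarith, norm_eq_zero.mp (by linarith)⟩

/-! ### Exclusion of contracting affine symbols on spaces of entire functions. -/

namespace H2

variable {β : WeightSequence}

lemma exists_extend_eq_eval (P : Polynomial ℂ) :
    ∃ q : H2 β, ∀ z ∈ domain β, extend q z = P.eval z := by
  induction P using Polynomial.induction_on' with
  | add P Q hP hQ =>
    obtain ⟨p, hp⟩ := hP
    obtain ⟨q, hq⟩ := hQ
    exact ⟨p + q, fun z hz => by rw [extend_add _ _ hz, hp z hz, hq z hz, Polynomial.eval_add]⟩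
  | monomial n c =>
    exact ⟨c • monomial β n, fun z _ => by
      rw [extend_smul, extend_monomial, Polynomial.eval_monomial]⟩

lemma norm_iterate_le (T : H2 β →L[ℂ] H2 β) (f : H2 β) (n : ℕ) :
    ‖T^[n] f‖ ≤ ‖T‖ ^ n * ‖f‖ := by
  induction n with
  | zero => simp
  | succ n ih =>
    rw [Function.iterate_succ_apply', pow_succ', mul_assoc]
    exact T.le_of_opNorm_le_of_le le_rfl ih

/-- If the functions in `H²(β)` are entire, then an invertible weighted composition operator
cannot have an affine composition symbol that contracts. -/
lemma one_le_norm_slope (hβ : rootLiminf β = ⊤) {W T : H2 β →L[ℂ] H2 β} (hWT : ∀ f, W (T f) = f)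
    {a b : ℂ} (ha : a ≠ 0) {Ψ : ℂ → ℂ} (hΨ : ∀ z, Ψ z ≠ 0)
    (hW : ∀ (f : H2 β) (z : ℂ), extend (W f) z = Ψ z * extend f (a * z + b)) : 1 ≤ ‖a‖ := by
  by_contra! ha1
  have hdom : ∀ z : ℂ, z ∈ domain β := fun z => by
    rw [mem_domain, hβ]
    exact enorm_lt_top
  have h1a : 1 - a ≠ 0 := fun h => by
    rw [← sub_eq_zero.mp h, norm_one] at ha1
    exact lt_irrefl _ ha1
  -- The fixed point of `z ↦ a * z + b`.
  set p := b / (1 - a) with hp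
  have hpb : p - b = a * p := by
    rw [hp]
    field_simp
    ring
  -- A zero of high order at `p` contributes a factor `a^k` at each application of `W`; `k` is
  -- chosen so that this beats the growth of `T^n` and of `Ψ(p)^n`.
  obtain ⟨k, hk⟩ : ∃ k : ℕ, ‖T‖ * ‖Ψ p‖ * ‖a‖ ^ k < 1 := by
    have h := (tendsto_pow_atTop_nhds_zero_of_lt_one (norm_nonneg a) ha1).const_mul
      (‖T‖ * ‖Ψ p‖)
    rw [mul_zero] at h
    exact (h.eventually_lt_const one_pos).exists
  obtain ⟨q, hq⟩ := exists_extend_eq_eval (β := β) ((Polynomial.X - Polynomial.C p) ^ k)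
  have hstep : ∀ (f : H2 β) (n : ℕ) (z : ℂ),
      extend (T^[n] f) z = Ψ z * extend (T^[n + 1] f) (a * z + b) := fun f n z => by
    rw [← hW, Function.iterate_succ_apply', hWT]
  have hp' : a * p + b = p := by linear_combination -hpb
  have hu : ∀ n, extend (T^[n] (monomial β 0)) p * Ψ p ^ n = 1 := fun n => by
    induction n with
    | zero => simp [extend_monomial]
    | succ n ih =>
      rw [hstep, hp'] at ih
      rw [← ih]
      ring
  -- Since `(a * z + b) - p = a * (z - p)`, multiplication by `(z - p)^k` commutes with `W` up to
  -- the factor `a^k`, and so with `T^n` up to `a^(-kn)`.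
  have hv : ∀ (n : ℕ) (z : ℂ), extend (T^[n] q) z * (a ^ k) ^ n =
      (z - p) ^ k * extend (T^[n] (monomial β 0)) z := fun n => by
    induction n with
    | zero =>
      intro z
      simp [hq z (hdom z), extend_monomial]
    | succ n ih =>
      intro z
      set w := (z - b) / a with hw
      have hwz : a * w + b = z := by
        rw [hw]
        field_simp
        ring
      have h1 := ih w
      rw [hstep q, hstep (monomial β 0), hwz] at h1
      have h2 : z - p = a * (w - p) := by linear_combination hp' - hwz
      rw [h2, mul_pow]
      refine mul_left_cancel₀ (hΨ w) ?_
      linear_combination a ^ k * h1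
  obtain ⟨C, hC⟩ := exists_norm_extend_le (β := β) (r := ‖p‖ + 1) (by positivity)
    (by rw [hβ]; exact ENNReal.ofReal_lt_top)
  have hC0 : 0 ≤ C := by
    have h := hC (monomial β 0) 0 (by simpa using (by positivity : (0 : ℝ) ≤ ‖p‖ + 1))
    rw [extend_monomial, pow_zero, norm_one, norm_monomial] at h
    have := β.pos 0
    by_contra!
    nlinarith
  -- On the circle `|z - p| = 1` the factor `(z - p)^k` is unimodular, so `T^n 1` inherits the bound
  -- for `T^n q`; the maximum principle carries it to the centre, where `hu` gives the exact value.
  have hsphere : ∀ n, ‖extend (T^[n] (monomial β 0)) p‖ ≤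
      C * ‖q‖ * (‖T‖ * ‖a‖ ^ k) ^ n := fun n => by
    refine Complex.norm_le_of_forall_mem_frontier_norm_le (U := ball p 1) isBounded_ball
      (f := extend (T^[n] (monomial β 0))) ?_ (fun z hz => ?_)
      (subset_closure (mem_ball_self one_pos))
    · have hd : Differentiable ℂ (extend (T^[n] (monomial β 0))) := fun z =>
        (analyticOnNhd_extend _ z (hdom z)).differentiableAt
      exact hd.diffContOnCl
    · rw [frontier_ball _ one_ne_zero, mem_sphere, dist_eq_norm] at hz
      have h1 := congrArg norm (hv n z)
      rw [norm_mul, norm_mul, norm_pow, norm_pow, norm_pow, hz, one_pow, one_mul] at h1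
      rw [← h1]
      have h2 : ‖z‖ ≤ ‖p‖ + 1 := by
        have := norm_add_le (z - p) p
        rw [sub_add_cancel, hz] at this
        linarith
      have h3 := hC (T^[n] q) z h2
      have h4 := mul_le_mul_of_nonneg_left (norm_iterate_le T q n) hC0
      calc ‖extend (T^[n] q) z‖ * (‖a‖ ^ k) ^ n
          ≤ C * (‖T‖ ^ n * ‖q‖) * (‖a‖ ^ k) ^ n := by gcongr; exact h3.trans h4
        _ = C * ‖q‖ * (‖T‖ * ‖a‖ ^ k) ^ n := by ring
  have hone : ∀ n : ℕ, 1 ≤ C * ‖q‖ * (‖T‖ * ‖Ψ p‖ * ‖a‖ ^ k) ^ n := fun n => by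
    have h1 := congrArg norm (hu n)
    rw [norm_mul, norm_pow, norm_one] at h1
    rw [← h1]
    calc _ ≤ C * ‖q‖ * (‖T‖ * ‖a‖ ^ k) ^ n * ‖Ψ p‖ ^ n := by gcongr; exact hsphere n
      _ = _ := by ring
  have hlim := (tendsto_pow_atTop_nhds_zero_of_lt_one (by positivity) hk).const_mul (C * ‖q‖)
  rw [mul_zero] at hlim
  exact absurd (ge_of_tendsto' hlim hone) (by norm_num)

end H2

/-! ### The three cases `R = 1`, `1 < R < ∞` and `R = ∞`. -/

open H2

lemma zeroExt_eqOn {F : ℂ → ℂ} {f : 𝔻 → ℂ} (h : ∀ z : 𝔻, F z = f z) :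
    EqOn (zeroExt f) F (ball 0 1) := fun z hz => by
  have hz' : ‖z‖ < 1 := by simpa using hz
  exact (zeroExt_coe f (.mk z hz')).trans (h _).symm

lemma IsRotation.isDiskAutomorphism {φ : 𝔻 → 𝔻} (hφ : IsAnalyticSelfmap φ) (h : IsRotation φ) :
    IsDiskAutomorphism φ := by
  obtain ⟨ζ, hζ, h⟩ := h
  have hc : conj ζ * ζ = 1 := by
    rw [Complex.conj_mul', hζ]
    simp
  refine ⟨hφ, fun z => .mk (conj ζ * z) (by
    rw [norm_mul, RCLike.norm_conj, hζ, one_mul]; exact z.norm_lt_one), ?_, fun z => ?_,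
    fun z => ?_⟩
  · refine DifferentiableOn.congr (f := fun z => conj ζ * z) (by fun_prop) (zeroExt_eqOn ?_)
    simp
  · refine Complex.UnitDisc.coe_injective ?_
    rw [Complex.UnitDisc.coe_mk, h, ← mul_assoc, hc, one_mul]
  · refine Complex.UnitDisc.coe_injective ?_
    rw [h, Complex.UnitDisc.coe_mk, ← mul_assoc, mul_comm ζ, hc, one_mul]

lemma mapsTo_ball_of_coe {Φ : ℂ → ℂ} {φ : 𝔻 → 𝔻} (h : ∀ z : 𝔻, Φ z = φ z) :
    MapsTo Φ (ball 0 1) (ball 0 1) := fun z hz => by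
  have h1 := h (.mk z (by simpa using hz))
  rw [Complex.UnitDisc.coe_mk] at h1
  rw [h1]
  simpa using (φ _).norm_lt_one

lemma domain_eq_ball {β : WeightSequence} {r : NNReal} (h : rootLiminf β = r) :
    domain β = ball 0 r := by
  rw [domain, h, eball_coe]

lemma isDiskAutomorphism_of_rootLiminf_eq_one {β : WeightSequence} {ψ : 𝔻 → ℂ} {φ : 𝔻 → 𝔻}
    (hφ : IsAnalyticSelfmap φ) {W : H2 β →L[ℂ] H2 β}
    (hW : ∀ f : H2 β, ⇑(W f) = weightedComp ψ φ ⇑f) (hinv : Function.Bijective W)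
    (hβ : rootLiminf β = 1) : IsDiskAutomorphism φ := by
  obtain ⟨Φ, χ, Ψ, -, hχ, -, hχm, hl, hr, hΦφ, -, -⟩ := exists_extended_symbols hφ hW hinv
  have hdom : domain β = ball 0 1 := by simpa using domain_eq_ball (r := 1) (by simpa using hβ)
  have hlt : ∀ z : 𝔻, ‖χ z‖ < 1 := fun z => by
    have := hχm (coe_mem_domain z)
    rw [hdom] at this
    simpa using this
  refine ⟨hφ, fun z => .mk (χ z) (hlt z), ?_, fun z => ?_, fun z => ?_⟩
  · rw [hdom] at hχ
    exact hχ.differentiableOn.congr (zeroExt_eqOn fun z => by simp)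
  · refine Complex.UnitDisc.coe_injective ?_
    rw [Complex.UnitDisc.coe_mk, ← hΦφ, hl _ (coe_mem_domain z)]
  · refine Complex.UnitDisc.coe_injective ?_
    rw [← hΦφ, Complex.UnitDisc.coe_mk, hr _ (coe_mem_domain z)]

lemma isRotation_of_one_lt_rootLiminf {β : WeightSequence} {ψ : 𝔻 → ℂ} {φ : 𝔻 → 𝔻}
    (hφ : IsAnalyticSelfmap φ) {W : H2 β →L[ℂ] H2 β}
    (hW : ∀ f : H2 β, ⇑(W f) = weightedComp ψ φ ⇑f) (hinv : Function.Bijective W)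
    (hβ : 1 < rootLiminf β) : IsRotation φ := by
  obtain ⟨Φ, χ, Ψ, hΦ, hχ, hΦm, hχm, hl, hr, hΦφ, hΨ, hWΨ⟩ := exists_extended_symbols hφ hW hinv
  have hdisk := mapsTo_ball_of_coe hΦφ
  rcases eq_or_ne (rootLiminf β) ⊤ with htop | htop
  · have hdom : ∀ z : ℂ, z ∈ domain β := fun z => by
      rw [mem_domain, htop]
      exact enorm_lt_top
    obtain ⟨a, b, ha, hab⟩ := exists_affine_of_entire_inverse
      (fun z => (hΦ z (hdom z)).differentiableAt) (fun z => (hχ z (hdom z)).differentiableAt)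
      (fun z => hl z (hdom z))
    let e := ContinuousLinearEquiv.ofBijective W (LinearMap.ker_eq_bot.mpr hinv.1)
      (LinearMap.range_eq_top.mpr hinv.2)
    have h1 : 1 ≤ ‖a‖ := one_le_norm_slope htop (W := W) (T := e.symm)
      (fun f => e.apply_symm_apply f) ha (fun z => hΨ z (hdom z))
      (fun f z => by rw [hWΨ f z (hdom z), hab])
    obtain ⟨ha1, rfl⟩ := affine_eq_rotation (b := b) h1 (by rwa [funext hab] at hdisk)
    exact ⟨a, ha1, fun z => by rw [← hΦφ, hab, add_zero]⟩
  · obtain ⟨r, hr'⟩ : ∃ r : NNReal, rootLiminf β = r :=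
      ⟨_, (ENNReal.coe_toNNReal htop).symm⟩
    have hdom := domain_eq_ball hr'
    have h1r : (1 : ℝ) < r := by
      rw [hr'] at hβ
      exact_mod_cast hβ
    rw [hdom] at hΦ hχ hΦm hχm hl hr
    obtain ⟨ζ, hζ, h⟩ := exists_rotation_of_mapsTo h1r hΦ.differentiableOn hχ.differentiableOn
      hΦm hχm hl hr hdisk
    exact ⟨ζ, hζ, fun z => by rw [← hΦφ, h _ (hdom ▸ coe_mem_domain z)]⟩

end WeightedHardy

end

theorem theorem3p5 (β : WeightedHardy.WeightSequence) (ψ : 𝔻 → ℂ) (φ : 𝔻 → 𝔻)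
    (hψ : WeightedHardy.IsAnalyticOnDisk ψ) (hφ : WeightedHardy.IsAnalyticSelfmap φ)
    (W : WeightedHardy.H2 β →L[ℂ] WeightedHardy.H2 β)
    (hW : ∀ f : WeightedHardy.H2 β, ⇑(W f) = WeightedHardy.weightedComp ψ φ ⇑f)
    (hinv : Function.Bijective W) :
    WeightedHardy.IsDiskAutomorphism φ ∧
      (1 < WeightedHardy.rootLiminf β → WeightedHardy.IsRotation φ) := by
  have hrot := WeightedHardy.isRotation_of_one_lt_rootLiminf hφ hW hinv
  refine ⟨?_, hrot⟩
  rcases β.one_le_rootLiminf.eq_or_lt with h | h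
  · exact WeightedHardy.isDiskAutomorphism_of_rootLiminf_eq_one hφ hW hinv h.symm
  · exact (hrot h).isDiskAutomorphism hφ
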